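/- Let $d,e,r\ge 1$, let $\zeta$ be a generator of the group $\mathcal U_{de}$ of complex $de$-th roots of unity, and let $G=G(de,1,r)=\mathcal U_{de}^r\rtimes\mathfrak S_r$ with $\sigma^{-1}(z_1,\dots,z_r)\sigma=(z_{\sigma(1)},\dots,z_{\sigma(r)})$. Let $\varepsilon(z\sigma)=(z_1\cdots z_r)^d$, a linear character of $G$ of order $e$ with kernel $G(de,e,r)$. Let $\underline\lambda=(\lambda^{(0)},\dots,\lambda^{(de-1)})$ be a $de$-multipartition of $r$ (indices modulo $de$), and put $c_i=|\lambda^{(i)}|$. Let $\mathcal X_c$ be the set of tuples $X=(X_0,\dots,X_{de-1})$ of disjoint sets with union $\{1,\dots,r\}$ and $|X_i|=c_i$. Let $V_\mu$ be the Specht module of a partition $\mu$, and $V_{\underline\lambda}=V_{\lambda^{(0)}}\otimes\cdots\otimes V_{\lambda^{(de-1)}}$, on which $z\in\mathcal U_{de}^r$ acts by the scalar $\alpha_c(z)=\prod_i\prod_{j=1}^{c_i} z_{c_0+\cdots+c_{i-1}+j}^{\,i}$. Let $\rho_{\underline\lambda}$ be the irreducible representation of $G$ on $W_{\underline\lambda}=\operatorname{Ind}_{\mathcal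 U_{de}^r\rtimes(\mathfrak S_{c_0}\times\cdots\times\mathfrak S_{c_{de-1}})}^{G}V_{\underline\lambda}=\bigoplus_{X\in\mathcal X_c}t_X\otimes V_{\underline\lambda}$, where $t_X\in\mathfrak S_r$ maps the $i$-th block $\{c_0+\cdots+c_{i-1}+1,\dots,c_0+\cdots+c_i\}$ increasingly onto $X_i$ for every $i$. Let $C_{\underline\lambda}=\{\varepsilon^j\mid \varepsilon^j\otimes\rho_{\underline\lambda}\cong\rho_{\underline\lambda}\}$, and let $b$ be a divisor of $e$ with $C_{\underline\lambda}=\langle\varepsilon^{b}\rangle$; then $\lambda^{(i+db)}=\lambda^{(i)}$ for all $i$. Let $M_{\underline\lambda}$ be the intertwiner of $\rho_{\underline\lambda}$ and $\varepsilon^{b}\otimes\rho_{\underline\lambda}$ given by $$M_{\underline\lambda}(t_X\otimes v_0\otimes\cdots\otimes v_{de-1})=t_{(X_{db},\dots,X_{db+de-1})}\otimes v_{db}\otimes\cdots\otimes v_{db+de-1},$$ and put $\Delta_{\underline\lambda,k}(g)=\operatorname{Tr}(M_{\underline\lambda}^k\circ\rho_{\underline\lambda}(g))$ for $g\in G$.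 Let $\underline\eta=(\eta_0,\dots,\eta_{de-1})$ be a $de$-multipartition of $r$, and let $g_{\underline\eta}=(z;\sigma)$ be a representative of the conjugacy class of $G$ labelled by $\underline\eta$ of the following form: the pairs $(\ell_1,u_1),\dots,(\ell_s,u_s)$ enumerate, in any order, all parts of $\underline\eta$ ($\ell_j$ being a part of $\eta_{u_j}$), $L_j=\ell_1+\cdots+\ell_{j-1}$, $\sigma=\sigma_1\cdots\sigma_s$ with $\sigma_j=(L_j+1\ \cdots\ L_j+\ell_j)$, $z_{L_j+1}=\zeta^{u_j}$ for all $j$, and all other $z_x$ are equal to $1$. Then for $0\le k\le|C_{\underline\lambda}|-1$, $$\Delta_{\underline\lambda,k}(g_{\underline\eta})=\Delta_{\underline\lambda,b'}(g_{\underline\eta}),$$ where $1\le b'\le|C_{\underline\lambda}|$ is such that the order of $M_{\underline\lambda}^k$ is $|C_{\underline\lambda}|/b'$. -/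

import Mathlib

open scoped TensorProduct

noncomputable section

namespace ReflectionGroup

/-! ### The group `G(n,1,r)` -/

/-- `G(n,1,r)`: the semidirect product of `(U_n)^r` by the symmetric group on `{0,…,r-1}`, where
`U_n` is the group of complex `n`-th roots of unity and `σ z σ⁻¹ = z ∘ σ⁻¹`. -/
abbrev GroupG (n r : ℕ) : Type :=
  (Fin r → rootsOfUnity n ℂ) ⋊[mulAutArrow] Equiv.Perm (Fin r)

/-- The linear character `(z;σ) ↦ (z_1 ⋯ z_r)^m` of `G(n,1,r)`. -/
def linChar (n r m : ℕ) : GroupG n r →* ℂˣ where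
  toFun g := (((∏ x, g.left x) ^ m : rootsOfUnity n ℂ) : ℂˣ)
  map_one' := by simp
  map_mul' g h := by
    have key : ∏ x, (g * h).left x = (∏ x, g.left x) * ∏ x, h.left x := by
      have e : ∀ x, (g * h).left x = g.left x * h.left (g.right⁻¹ x) := fun _ => rfl
      simp only [e, Finset.prod_mul_distrib]
      congr 1
      exact Equiv.prod_comp g.right⁻¹ (fun y => h.left y)
    rw [key, mul_pow]
    rfl

/-! ### Specht modules -/

/-- The permutation of labels: `S_m` acts on functions `Fin m → ℕ` (a function records
the row of every label) by `π f = f ∘ π⁻¹`, and linearly on formal combinations of them. -/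
def tabloidRep (m : ℕ) : Representation ℂ (Equiv.Perm (Fin m)) ((Fin m → ℕ) →₀ ℂ) where
  toFun π := Finsupp.lmapDomain ℂ ℂ (fun f => f ∘ ⇑π⁻¹)
  map_one' := by
    ext f
    simp [Finsupp.mapDomain_single]
  map_mul' π τ := by
    ext f
    simp [Finsupp.mapDomain_single, Function.comp_assoc]

/-- A (bijective) tableau of shape `μ` with labels `0,…,|μ|-1`. -/
abbrev Tableau (μ : YoungDiagram) : Type := μ.cells ≃ Fin μ.card

/-- The tabloid of a tableau `T`: every label is sent to the index of its row. -/
def tabloid {μ : YoungDiagram} (T : Tableau μ) : Fin μ.card → ℕ := fun x => (T.symm x).1.1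

open Classical in
/-- The column stabilizer of a tableau. -/
def colStab {μ : YoungDiagram} (T : Tableau μ) : Finset (Equiv.Perm (Fin μ.card)) :=
  Finset.univ.filter fun σ => ∀ x, (T.symm (σ x)).1.2 = (T.symm x).1.2

/-- The polytabloid `e_T = ∑ sgn(σ) {σ T}`, `σ` running over the column stabilizer of `T`. -/
def polytabloid {μ : YoungDiagram} (T : Tableau μ) : (Fin μ.card → ℕ) →₀ ℂ :=
  ∑ σ ∈ colStab T, ((Equiv.Perm.sign σ : ℤ) : ℂ) • Finsupp.single (tabloid (T.trans σ)) 1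

theorem tabloidRep_polytabloid {μ : YoungDiagram} (T : Tableau μ)
    (π : Equiv.Perm (Fin μ.card)) :
    tabloidRep μ.card π (polytabloid T) = polytabloid (T.trans π) := by
  unfold polytabloid
  rw [map_sum]
  refine Finset.sum_bij' (fun σ _ => π * σ * π⁻¹) (fun σ _ => π⁻¹ * σ * π) ?_ ?_ ?_ ?_ ?_
  · intro σ hσ
    simp only [colStab, Finset.mem_filter, Finset.mem_univ, true_and] at hσ ⊢
    intro x
    simpa using hσ (π.symm x)
  · intro σ hσ
    simp only [colStab, Finset.mem_filter, Finset.mem_univ, true_and] at hσ ⊢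
    intro x
    simpa using hσ (π x)
  · intro σ _
    group
  · intro σ _
    group
  · intro σ _
    have h : tabloid (T.trans σ) ∘ ⇑π⁻¹ = tabloid ((T.trans π).trans (π * σ * π⁻¹)) := by
      funext x
      simp [tabloid, Equiv.Perm.mul_def, Equiv.Perm.inv_def]
    simp only [map_smul, Equiv.Perm.sign_mul, Equiv.Perm.sign_inv]
    rw [mul_right_comm, Int.units_mul_self, one_mul, ← h]
    simp [tabloidRep, Finsupp.mapDomain_single]

/-- The Specht module `V_μ`: the span of all polytabloids of shape `μ`. -/
def spechtSubmodule (μ : YoungDiagram) : Submodule ℂ ((Fin μ.card → ℕ) →₀ ℂ) :=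
  Submodule.span ℂ (Set.range (polytabloid (μ := μ)))

/-- The space of the Specht module `V_μ`. -/
abbrev Specht (μ : YoungDiagram) : Type := spechtSubmodule μ

theorem spechtSubmodule_le_comap (μ : YoungDiagram) (π : Equiv.Perm (Fin μ.card)) :
    spechtSubmodule μ ≤ (spechtSubmodule μ).comap (tabloidRep μ.card π) := by
  refine Submodule.span_le.2 ?_
  rintro _ ⟨T, rfl⟩
  exact Submodule.subset_span ⟨T.trans π, (tabloidRep_polytabloid T π).symm⟩

/-- The representation `ψ_μ` of the symmetric group `S_{|μ|}` on the Specht module `V_μ`. -/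
def spechtRep (μ : YoungDiagram) : Representation ℂ (Equiv.Perm (Fin μ.card)) (Specht μ) :=
  (tabloidRep μ.card).subrepresentation (spechtSubmodule μ) (spechtSubmodule_le_comap μ)

/-! ### Multipartitions and the irreducible modules of `G(n,1,r)` -/

/-- An `n`-multipartition of `r`, its components being indexed modulo `n`. -/
structure MultiPartition (n r : ℕ) [NeZero n] where
  /-- The components. -/
  part : ZMod n → YoungDiagram
  /-- The sizes of the components add up to `r`. -/
  sum_card : ∑ i, (part i).card = r

variable {n r : ℕ} [NeZero n]

/-- The set `𝒳_c` of the tuples `(X_0,…,X_{n-1})` of pairwise disjoint sets with union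
`{0,…,r-1}` and `|X_i| = c_i = |λ^(i)|`. -/
structure SetTuple (lam : MultiPartition n r) where
  /-- The sets `X_i`. -/
  part : ZMod n → Finset (Fin r)
  /-- They are pairwise disjoint and cover everything. -/
  existsUnique_mem : ∀ x, ∃! i, x ∈ part i
  /-- `X_i` has as many elements as `λ^(i)` has cells. -/
  card_part : ∀ i, (part i).card = (lam.part i).card

namespace SetTuple

variable {lam : MultiPartition n r}

@[ext] theorem ext {X Y : SetTuple lam} (h : ∀ i, X.part i = Y.part i) : X = Y := by
  cases X
  cases Y
  congr
  exact funext h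

/-- The tuple `X_σ = (σ(X_0),…,σ(X_{n-1}))`. -/
def image (σ : Equiv.Perm (Fin r)) (X : SetTuple lam) : SetTuple lam where
  part i := (X.part i).map σ.toEmbedding
  existsUnique_mem x := by
    simpa [Finset.mem_map_equiv] using X.existsUnique_mem (σ.symm x)
  card_part i := by rw [Finset.card_map, X.card_part]

/-- The increasing enumeration `x_{i,0} < x_{i,1} < ⋯` of `X_i`. -/
def enum (X : SetTuple lam) (i : ZMod n) : Fin (lam.part i).card ≃ X.part i :=
  ((X.part i).orderIsoOfFin (X.card_part i)).toEquiv

/-- The bijection `X_i → σ(X_i)` given by `σ`. -/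
def imageEquiv (σ : Equiv.Perm (Fin r)) (X : SetTuple lam) (i : ZMod n) :
    X.part i ≃ (X.image σ).part i :=
  σ.subtypeEquiv fun a => by simp [image]

/-- The permutation `σ̃_i` of `{0,…,c_i-1}` with `σ(x_{i,k}) = x'_{i,σ̃_i(k)}`, where `x_{i,·}` and
`x'_{i,·}` are the increasing enumerations of `X_i` and `σ(X_i)`. So
`σ t_X = t_{X_σ} σ̃_0 ⋯ σ̃_{n-1}`. -/
def stdPerm (σ : Equiv.Perm (Fin r)) (X : SetTuple lam) (i : ZMod n) :
    Equiv.Perm (Fin (lam.part i).card) :=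
  ((X.enum i).trans (X.imageEquiv σ i)).trans ((X.image σ).enum i).symm

/-- The scalar `∏_i ∏_{x ∈ X_i} z_x^i`, which is `α_c(z_{t_X(1)},…,z_{t_X(r)})`. -/
def scalar (X : SetTuple lam) (z : Fin r → rootsOfUnity n ℂ) : ℂ :=
  ∏ i, ∏ x ∈ X.part i, ((z x : ℂˣ) : ℂ) ^ i.val

theorem image_one (X : SetTuple lam) : X.image 1 = X := by
  ext i x
  simp only [image, Finset.mem_map_equiv]
  rfl

theorem image_mul (σ τ : Equiv.Perm (Fin r)) (X : SetTuple lam) :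
    X.image (σ * τ) = (X.image τ).image σ := by
  ext i x
  simp only [image, Finset.mem_map_equiv]
  rfl

theorem enum_congr {X Y : SetTuple lam} (h : X = Y) (i : ZMod n) (k : Fin (lam.part i).card) :
    (X.enum i k : Fin r) = Y.enum i k := by
  subst h
  rfl

theorem enum_stdPerm (σ : Equiv.Perm (Fin r)) (X : SetTuple lam) (i : ZMod n)
    (k : Fin (lam.part i).card) :
    ((X.image σ).enum i (X.stdPerm σ i k) : Fin r) = σ (X.enum i k) := by
  simp [stdPerm, imageEquiv]

theorem stdPerm_one (X : SetTuple lam) (i : ZMod n) : X.stdPerm 1 i = 1 := by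
  ext1 k
  apply (X.enum i).injective
  apply Subtype.ext
  rw [← enum_congr X.image_one i, enum_stdPerm]
  rfl

theorem stdPerm_mul (σ τ : Equiv.Perm (Fin r)) (X : SetTuple lam) (i : ZMod n) :
    X.stdPerm (σ * τ) i = (X.image τ).stdPerm σ i * X.stdPerm τ i := by
  ext1 k
  apply ((X.image (σ * τ)).enum i).injective
  apply Subtype.ext
  rw [enum_stdPerm, enum_congr (X.image_mul σ τ) i, Equiv.Perm.mul_apply, Equiv.Perm.mul_apply,
    enum_stdPerm, enum_stdPerm]

theorem scalar_one (X : SetTuple lam) : X.scalar 1 = 1 := by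
  simp [scalar]

theorem scalar_mul (X : SetTuple lam) (z w : Fin r → rootsOfUnity n ℂ) :
    X.scalar (z * w) = X.scalar z * X.scalar w := by
  simp [scalar, mul_pow, Finset.prod_mul_distrib]

theorem scalar_image (σ : Equiv.Perm (Fin r)) (X : SetTuple lam)
    (z : Fin r → rootsOfUnity n ℂ) :
    (X.image σ).scalar (mulAutArrow σ z) = X.scalar z := by
  have h : ∀ x, (mulAutArrow σ z) (σ x) = z x := fun x => congrArg z (σ.symm_apply_apply x)
  simp only [scalar, image, Finset.prod_map, Equiv.coe_toEmbedding, h]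

end SetTuple

/-- The space `V_λ = V_{λ^(0)} ⊗ ⋯ ⊗ V_{λ^(n-1)}`. -/
abbrev TensorSpace (lam : MultiPartition n r) : Type := ⨂[ℂ] i, Specht (lam.part i)

/-- The space `W_λ`, with the elements `t_X ⊗ v` (`X ∈ 𝒳_c`, `v ∈ V_λ`) written
`Finsupp.single X v`: it is the direct sum of the subspaces `t_X ⊗ V_λ`. -/
abbrev ModuleW (lam : MultiPartition n r) : Type := SetTuple lam →₀ TensorSpace lam

/-- The representation `ρ_λ` of `G(n,1,r)` on `W_λ`, induced from the representation `V_λ` of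
`(U_n)^r ⋊ (S_{c_0} × ⋯ × S_{c_{n-1}})`, in terms of the coset representatives `t_X`:
`ρ_λ(zσ)(t_X ⊗ v_0 ⊗ ⋯ ⊗ v_{n-1}) = α_c(z ∘ t_{X_σ}) t_{X_σ} ⊗ σ̃_0 v_0 ⊗ ⋯ ⊗ σ̃_{n-1} v_{n-1}`. -/
def rho (lam : MultiPartition n r) : Representation ℂ (GroupG n r) (ModuleW lam) where
  toFun g := Finsupp.lsum ℂ fun X : SetTuple lam =>
    (X.image g.right).scalar g.left •
      (Finsupp.lsingle (X.image g.right) ∘ₗ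
        PiTensorProduct.map fun i => spechtRep (lam.part i) (X.stdPerm g.right i))
  map_one' := by
    refine Finsupp.lhom_ext fun X v => ?_
    simp [SetTuple.image_one, SetTuple.stdPerm_one, SetTuple.scalar_one, Module.End.one_eq_id,
      PiTensorProduct.map_id]
  map_mul' g h := by
    refine Finsupp.lhom_ext fun X v => ?_
    have hs : (X.image (g * h).right).scalar (g * h).left =
        ((X.image h.right).image g.right).scalar g.left * (X.image h.right).scalar h.left := by
      rw [SemidirectProduct.mul_right, SemidirectProduct.mul_left, SetTuple.image_mul,
        SetTuple.scalar_mul, SetTuple.scalar_image]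
    rw [Module.End.mul_apply, Finsupp.lsum_single, Finsupp.lsum_single, hs]
    simp only [LinearMap.smul_apply, LinearMap.comp_apply, Finsupp.lsingle_apply, map_smul,
      Finsupp.lsum_single, SemidirectProduct.mul_right, SetTuple.image_mul,
      SetTuple.stdPerm_mul, map_mul, PiTensorProduct.map_mul, Module.End.mul_apply, smul_smul]
    rw [mul_comm]

/-! ### Twisting by linear characters, the group `C_λ` and the intertwiner `M_λ` -/

/-- The representation `χ ⊗ ρ` for a linear character `χ`. -/
def twist {G W : Type*} [Group G] [AddCommMonoid W] [Module ℂ W] (χ : G →* ℂˣ)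
    (ρ : Representation ℂ G W) : Representation ℂ G W where
  toFun g := ((χ g : ℂˣ) : ℂ) • ρ g
  map_one' := by simp
  map_mul' g h := by simp [smul_smul, mul_comm]

/-- The linear character `ε` of `G(de,1,r)`, whose kernel is `G(de,e,r)`:
`ε(zσ) = (z_1 ⋯ z_r)^d`. -/
abbrev eps (d e r : ℕ) : GroupG (d * e) r →* ℂˣ := linChar (d * e) r d

/-- `C_λ = {ε^j | ε^j ⊗ ρ_λ ≅ ρ_λ}`. -/
def stabilizerC (d e r : ℕ) [NeZero (d * e)] (lam : MultiPartition (d * e) r) :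
    Set (GroupG (d * e) r →* ℂˣ) :=
  {χ | (∃ j : ℕ, χ = eps d e r ^ j) ∧ Nonempty ((twist χ (rho lam)).Equiv (rho lam))}

/-- `m(X_0,…,X_{n-1}) = (X_a,…,X_{a+n-1})`, indices modulo `n`, when `λ` is invariant under the
same shift. -/
def SetTuple.shift {lam : MultiPartition n r} (a : ZMod n)
    (h : ∀ i, lam.part (i + a) = lam.part i) (X : SetTuple lam) : SetTuple lam where
  part i := X.part (i + a)
  existsUnique_mem x := by
    obtain ⟨i, hi, hu⟩ := X.existsUnique_mem x
    refine ⟨i - a, by simpa using hi, fun j hj => ?_⟩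
    rw [← hu (j + a) hj, add_sub_cancel_right]
  card_part i := by rw [X.card_part, h]

/-- The identification of the Specht modules of two equal partitions. -/
def spechtCast {μ ν : YoungDiagram} (h : μ = ν) : Specht μ ≃ₗ[ℂ] Specht ν :=
  h ▸ LinearEquiv.refl ℂ (Specht μ)

theorem spechtCast_update (lam : MultiPartition n r) (a : ZMod n)
    (h : ∀ i, lam.part (i + a) = lam.part i) [DecidableEq (ZMod n)]
    (v : ∀ i, Specht (lam.part i)) (j : ZMod n) (x : Specht (lam.part (j + a))) :
    (fun i => spechtCast (h i) (Function.update v (j + a) x (i + a))) =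
      Function.update (fun i => spechtCast (h i) (v (i + a))) j (spechtCast (h j) x) := by
  funext i
  by_cases hij : i = j
  · subst hij
    simp
  · simp [hij]

/-- The map `v_0 ⊗ ⋯ ⊗ v_{n-1} ↦ v_a ⊗ ⋯ ⊗ v_{a+n-1}` (indices modulo `n`) of `V_λ`, when `λ` is
invariant under the same shift. -/
def tensorShift (lam : MultiPartition n r) (a : ZMod n)
    (h : ∀ i, lam.part (i + a) = lam.part i) : Module.End ℂ (TensorSpace lam) :=
  PiTensorProduct.lift
    { toFun := fun v => PiTensorProduct.tprod ℂ fun i => spechtCast (h i) (v (i + a))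
      map_update_add' := by
        intro _ v j x y
        obtain ⟨j, rfl⟩ : ∃ j', j = j' + a := ⟨j - a, by simp⟩
        simp only [spechtCast_update, map_add, MultilinearMap.map_update_add]
      map_update_smul' := by
        intro _ v j c x
        obtain ⟨j, rfl⟩ : ∃ j', j = j' + a := ⟨j - a, by simp⟩
        simp only [spechtCast_update, map_smul, MultilinearMap.map_update_smul] }

theorem tensorShift_tprod (lam : MultiPartition n r) (a : ZMod n)
    (h : ∀ i, lam.part (i + a) = lam.part i) (v : ∀ i, Specht (lam.part i)) :
    tensorShift lam a h (PiTensorProduct.tprod ℂ v) =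
      PiTensorProduct.tprod ℂ fun i => spechtCast (h i) (v (i + a)) :=
  PiTensorProduct.lift.tprod v

open Classical in
/-- The map `t_X ⊗ v_0 ⊗ ⋯ ⊗ v_{n-1} ↦ t_{m(X)} ⊗ v_a ⊗ ⋯ ⊗ v_{a+n-1}` of `W_λ`, where
`m(X) = (X_a,…,X_{a+n-1})` and indices are modulo `n`. It makes sense when
`λ^(i+a) = λ^(i)` for all `i`; otherwise the identity is taken as a default value. -/
def shiftW (lam : MultiPartition n r) (a : ZMod n) : Module.End ℂ (ModuleW lam) :=
  if h : ∀ i, lam.part (i + a) = lam.part i then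
    Finsupp.lsum ℂ fun X => Finsupp.lsingle (X.shift a h) ∘ₗ tensorShift lam a h
  else 1

/-- The intertwiner `M_λ` of `ρ_λ` and `ε^b ⊗ ρ_λ`: it shifts by `db`. -/
def intertwinerM (d e r : ℕ) [NeZero (d * e)] (lam : MultiPartition (d * e) r) (b : ℕ) :
    Module.End ℂ (ModuleW lam) :=
  shiftW lam ((d * b : ℕ) : ZMod (d * e))

/-- `Δ_{λ,k}(g) = Tr(M_λ^k ∘ ρ_λ(g))`, where `M_λ` is the shift by `db`. -/
def Delta (d e r : ℕ) [NeZero (d * e)] (lam : MultiPartition (d * e) r) (b k : ℕ)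
    (g : GroupG (d * e) r) : ℂ :=
  LinearMap.trace ℂ (ModuleW lam) ((intertwinerM d e r lam b ^ k) ∘ₗ rho lam g)

/-! ### Representatives of the conjugacy classes -/

/-- The element `(z;σ)` of `G(n,1,r)` with `σ` the cycle `(a, a+1, …, a+l-1)`, `z_a = ζ^u` and all
other `z_x` equal to `1`. -/
def cycleElt (r : ℕ) [NeZero r] (ζ : rootsOfUnity n ℂ) (a l : ℕ) (u : ZMod n) : GroupG n r :=
  ⟨Pi.mulSingle (Fin.ofNat r a) (ζ ^ u.val),
    ((List.range' a l).map (Fin.ofNat r)).formPerm⟩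

/-- For a list of pairs `(l_1,u_1), (l_2,u_2), …`, the product of the cycles of lengths
`l_1, l_2, …` with cycle products `ζ^{u_1}, ζ^{u_2}, …` on consecutive intervals, the first of
which starts at `a`. -/
def cyclesFrom (r : ℕ) [NeZero r] (ζ : rootsOfUnity n ℂ) : ℕ → List (ℕ × ZMod n) → GroupG n r
  | _, [] => 1
  | a, (l, u) :: L => cycleElt r ζ a l u * cyclesFrom r ζ (a + l) L

/-- The list `(l_1,u_1), (l_2,u_2), …` enumerates the parts of the multipartition `η`: for every
`u`, the parts of `η_u` are the `l_j` with `u_j = u`, with multiplicities. -/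
def Enumerates (L : List (ℕ × ZMod n)) (eta : MultiPartition n r) : Prop :=
  ∀ u, (((L.filter fun p => p.2 = u).map Prod.fst : List ℕ) : Multiset ℕ) =
    ((eta.part u).rowLens : Multiset ℕ)

end ReflectionGroup

end

open ReflectionGroup

namespace ReflectionGroup

section

variable {n r : ℕ} [NeZero n] {lam : MultiPartition n r}

/-! ### Permuting the components of a multipartition -/

/-! Write `a` for `db` modulo `de`. Then `M^k` is the shift by `k • a`, and `|C|` is the additive
order of `a`, so the condition on `b'` forces `b' = gcd(|C|, k)`. Hence `k • a` and `b' • a`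
generate the same subgroup of `ZMod (d * e)`, and it suffices that the trace of a shift composed
with `ρ(z;σ)` depends only on the subgroup generated by the shift (`trace_shiftW_mul_rho_eq`).

Only the blocks of tuples `X` fixed by `σ` followed by the shift contribute, each with a scalar
coming from `z` times a trace that involves only `σ`. Translations by two generators of one subgroup
are conjugate under a permutation `π` that preserves its cosets (`exists_perm_conj_translation`),
hence preserves `λ`. Permuting components by `π` commutes with the symmetric group but not with `z`,
so it alone would change the scalars. It is corrected by a permutation `φ` commuting with `σ`, equal
on each cycle to a power of `σ`, chosen to restore the label of one representative of that cycle
(`exists_isShiftFixed_of_zmultiples_eq`). A fixed tuple is determined by these labels, so this is a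
bijection between the tuples fixed for the two shifts, with equal block traces.

The form of the class representative enters in the scalars: each cycle of `σ` has at most one `x`
with `z_x ≠ 1` (`cyclesFrom_marks`). Choosing `σ⁻¹ x` as its representative makes the scalars depend
only on the preserved labels. -/

theorem spechtCast_spechtCast {μ ν κ : YoungDiagram} (h₁ : μ = ν) (h₂ : ν = κ) (v : Specht μ) :
    spechtCast h₂ (spechtCast h₁ v) = spechtCast (h₁.trans h₂) v := by
  subst h₁ h₂
  rfl

theorem spechtCast_spechtRep {μ ν : YoungDiagram} (h : μ = ν) (p : Equiv.Perm (Fin μ.card))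
    (q : Equiv.Perm (Fin ν.card))
    (hpq : ∀ k, q (Fin.cast (congrArg YoungDiagram.card h) k) =
      Fin.cast (congrArg YoungDiagram.card h) (p k)) (v : Specht μ) :
    spechtCast h (spechtRep μ p v) = spechtRep ν q (spechtCast h v) := by
  subst h
  obtain rfl : q = p := Equiv.ext hpq
  rfl

namespace SetTuple

/-- The tuple `(X_{π(0)},…,X_{π(n-1)})`, when `λ` is invariant under `π`. -/
def permute (π : Equiv.Perm (ZMod n)) (h : ∀ i, lam.part (π i) = lam.part i)
    (X : SetTuple lam) : SetTuple lam where
  part i := X.part (π i)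
  existsUnique_mem x := by
    obtain ⟨i, hi, hu⟩ := X.existsUnique_mem x
    refine ⟨π.symm i, by simpa using hi, fun j hj => ?_⟩
    rw [← hu (π j) hj, Equiv.symm_apply_apply]
  card_part i := by rw [X.card_part, h]

theorem enum_permute (π : Equiv.Perm (ZMod n)) (h : ∀ i, lam.part (π i) = lam.part i)
    (X : SetTuple lam) (i : ZMod n) (k : Fin (lam.part (π i)).card) :
    ((X.permute π h).enum i (Fin.cast (congrArg YoungDiagram.card (h i)) k) : Fin r) =
      X.enum (π i) k := by
  -- The increasing enumeration depends only on the set; with both cardinalities made variables, the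
  -- cast disappears under `subst`.
  have key : ∀ (s : Finset (Fin r)) (a b : ℕ) (ha : s.card = a) (hb : s.card = b) (hab : a = b)
      (k : Fin a), s.orderEmbOfFin hb (Fin.cast hab k) = s.orderEmbOfFin ha k := by
    intro s a b ha hb hab k
    subst hab
    rfl
  exact key (X.part (π i)) _ _ (X.card_part _) ((X.permute π h).card_part i) _ k

theorem stdPerm_permute (π : Equiv.Perm (ZMod n)) (h : ∀ i, lam.part (π i) = lam.part i)
    (σ : Equiv.Perm (Fin r)) (X : SetTuple lam) (i : ZMod n) (k : Fin (lam.part (π i)).card) :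
    (X.permute π h).stdPerm σ i (Fin.cast (congrArg YoungDiagram.card (h i)) k) =
      Fin.cast (congrArg YoungDiagram.card (h i)) (X.stdPerm σ (π i) k) := by
  apply (((X.permute π h).image σ).enum i).injective
  apply Subtype.ext
  rw [enum_stdPerm, enum_permute]
  exact (enum_stdPerm σ X (π i) k).symm.trans (enum_permute π h (X.image σ) i _).symm

end SetTuple

/-- The map `v_0 ⊗ ⋯ ⊗ v_{n-1} ↦ v_{π(0)} ⊗ ⋯ ⊗ v_{π(n-1)}` of `V_λ`, when `λ` is invariant
under `π`. -/
noncomputable def tensorPerm (lam : MultiPartition n r) (π : Equiv.Perm (ZMod n))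
    (h : ∀ i, lam.part (π i) = lam.part i) : Module.End ℂ (TensorSpace lam) :=
  (PiTensorProduct.map fun i => (spechtCast (h i)).toLinearMap) ∘ₗ
    (PiTensorProduct.reindex ℂ (fun i => Specht (lam.part i)) π.symm).toLinearMap

theorem tensorPerm_tprod (π : Equiv.Perm (ZMod n)) (h : ∀ i, lam.part (π i) = lam.part i)
    (v : ∀ i, Specht (lam.part i)) :
    tensorPerm lam π h (PiTensorProduct.tprod ℂ v) =
      PiTensorProduct.tprod ℂ fun i => spechtCast (h i) (v (π i)) := by
  rw [tensorPerm, LinearMap.comp_apply, LinearEquiv.coe_coe, PiTensorProduct.reindex_tprod]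
  exact PiTensorProduct.map_tprod _ _

/-- The map `t_X ⊗ v_0 ⊗ ⋯ ⊗ v_{n-1} ↦ t_{X∘π} ⊗ v_{π(0)} ⊗ ⋯ ⊗ v_{π(n-1)}` of `W_λ`, when `λ`
is invariant under `π`. -/
noncomputable def permW (lam : MultiPartition n r) (π : Equiv.Perm (ZMod n))
    (h : ∀ i, lam.part (π i) = lam.part i) : Module.End ℂ (ModuleW lam) :=
  Finsupp.lsum ℂ fun X => Finsupp.lsingle (X.permute π h) ∘ₗ tensorPerm lam π h

theorem permW_single (π : Equiv.Perm (ZMod n)) (h : ∀ i, lam.part (π i) = lam.part i)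
    (X : SetTuple lam) (v : TensorSpace lam) :
    permW lam π h (Finsupp.single X v) =
      Finsupp.single (X.permute π h) (tensorPerm lam π h v) := by
  simp [permW]

/-- Linear maps on `W_λ` agree as soon as they agree on the elements
`t_X ⊗ v_0 ⊗ ⋯ ⊗ v_{n-1}`. -/
theorem moduleW_hom_ext {f g : Module.End ℂ (ModuleW lam)}
    (hfg : ∀ X v, f (Finsupp.single X (PiTensorProduct.tprod ℂ v)) =
      g (Finsupp.single X (PiTensorProduct.tprod ℂ v))) : f = g := by
  refine Finsupp.lhom_ext' fun X => PiTensorProduct.ext ?_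
  ext v : 1
  exact hfg X v

/-- The order is reversed because permuting components is precomposition: `(X ∘ π') ∘ π = X ∘ (π' *
π)`. -/
theorem permW_mul (π π' : Equiv.Perm (ZMod n)) (h : ∀ i, lam.part (π i) = lam.part i)
    (h' : ∀ i, lam.part (π' i) = lam.part i)
    (hmul : ∀ i, lam.part ((π' * π) i) = lam.part i) :
    permW lam π h * permW lam π' h' = permW lam (π' * π) hmul := by
  refine moduleW_hom_ext fun X v => ?_
  rw [Module.End.mul_apply, permW_single, permW_single, permW_single, tensorPerm_tprod,
    tensorPerm_tprod, tensorPerm_tprod]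
  simp only [spechtCast_spechtCast]
  rfl

theorem permW_congr {π π' : Equiv.Perm (ZMod n)} (hπ : π = π')
    (h : ∀ i, lam.part (π i) = lam.part i) (h' : ∀ i, lam.part (π' i) = lam.part i) :
    permW lam π h = permW lam π' h' := by
  subst hπ
  rfl

theorem permW_one (h : ∀ i, lam.part ((1 : Equiv.Perm (ZMod n)) i) = lam.part i) :
    permW lam 1 h = 1 := by
  refine moduleW_hom_ext fun X v => ?_
  rw [permW_single, tensorPerm_tprod]
  rfl

/-- Shifts are embedded among all permutations of components because the permutation conjugating two
shifts need not itself be a shift. -/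
theorem shiftW_eq_permW (a : ZMod n) (h : ∀ i, lam.part (Equiv.addRight a i) = lam.part i) :
    shiftW lam a = permW lam (Equiv.addRight a) h := by
  have h' : ∀ i, lam.part (i + a) = lam.part i := h
  rw [shiftW, dif_pos h']
  refine moduleW_hom_ext fun X v => ?_
  rw [permW_single, tensorPerm_tprod, Finsupp.lsum_single, LinearMap.comp_apply,
    tensorShift_tprod]
  rfl

theorem part_addRight_nsmul {a : ZMod n} (h : ∀ i, lam.part (i + a) = lam.part i) (k : ℕ)
    (i : ZMod n) : lam.part (Equiv.addRight (k • a) i) = lam.part i := by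
  change lam.part (i + k • a) = lam.part i
  induction k with
  | zero => simp
  | succ k ih => rw [succ_nsmul, ← add_assoc, h, ih]

theorem shiftW_pow (a : ZMod n) (h : ∀ i, lam.part (i + a) = lam.part i) (k : ℕ) :
    shiftW lam a ^ k = shiftW lam (k • a) := by
  have h' : ∀ i, lam.part (Equiv.addRight a i) = lam.part i := h
  rw [shiftW_eq_permW (k • a) (part_addRight_nsmul h k), shiftW_eq_permW a h']
  induction k with
  | zero =>
    rw [pow_zero, ← permW_one (lam := lam) fun _ => rfl]
    exact permW_congr (by ext; simp) _ _
  | succ k ih =>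
    have e : Equiv.addRight a * Equiv.addRight (k • a) = Equiv.addRight ((k + 1) • a) :=
      Equiv.ext fun i => show i + k • a + a = i + (k + 1) • a by rw [succ_nsmul, add_assoc]
    rw [pow_succ, ih, permW_mul _ _ _ _ fun i => by rw [e]; exact part_addRight_nsmul h _ i]
    exact permW_congr e _ _

/-! ### The action of the symmetric group on `W_λ` -/

theorem rho_single (g : GroupG n r) (X : SetTuple lam) (v : TensorSpace lam) :
    rho lam g (Finsupp.single X v) = (X.image g.right).scalar g.left •
      Finsupp.single (X.image g.right)
        (PiTensorProduct.map (fun i => spechtRep (lam.part i) (X.stdPerm g.right i)) v) := by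
  simp [rho]

theorem rho_inr_single (σ : Equiv.Perm (Fin r)) (X : SetTuple lam) (v : TensorSpace lam) :
    rho lam (SemidirectProduct.inr σ) (Finsupp.single X v) =
      Finsupp.single (X.image σ)
        (PiTensorProduct.map (fun i => spechtRep (lam.part i) (X.stdPerm σ i)) v) := by
  simp [rho_single, SetTuple.scalar_one]

/-- One action moves points, the other renames components. The diagonal part of the group is left
out: it acts through exponents that depend on the names. -/
theorem rho_inr_mul_permW (σ : Equiv.Perm (Fin r)) (π : Equiv.Perm (ZMod n))
    (h : ∀ i, lam.part (π i) = lam.part i) :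
    rho lam (SemidirectProduct.inr σ) * permW lam π h =
      permW lam π h * rho lam (SemidirectProduct.inr σ) := by
  refine moduleW_hom_ext fun X v => ?_
  rw [Module.End.mul_apply, Module.End.mul_apply, permW_single, rho_inr_single, rho_inr_single,
    permW_single, tensorPerm_tprod, PiTensorProduct.map_tprod, PiTensorProduct.map_tprod,
    tensorPerm_tprod]
  congr 1
  congr 1
  funext i
  exact (spechtCast_spechtRep (h i) _ _ (X.stdPerm_permute π h σ i) _).symm

/-! ### Labels -/

namespace SetTuple

instance : Finite (SetTuple lam) :=
  Finite.of_injective SetTuple.part fun _ _ h => SetTuple.ext (congrFun h)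

/-- The index `i` of the set `X_i` that contains `x`. -/
noncomputable def label (X : SetTuple lam) (x : Fin r) : ZMod n :=
  (X.existsUnique_mem x).choose

theorem mem_part_iff (X : SetTuple lam) (x : Fin r) (i : ZMod n) :
    x ∈ X.part i ↔ X.label x = i := by
  have h := (X.existsUnique_mem x).choose_spec
  refine ⟨fun hi => (h.2 i hi).symm, ?_⟩
  rintro rfl
  exact h.1

theorem ext_label {X Y : SetTuple lam} (h : ∀ x, X.label x = Y.label x) : X = Y := by
  ext i x
  rw [mem_part_iff, mem_part_iff, h]

theorem label_image (σ : Equiv.Perm (Fin r)) (X : SetTuple lam) (x : Fin r) :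
    (X.image σ).label x = X.label (σ⁻¹ x) := by
  rw [← mem_part_iff, image, Finset.mem_map_equiv]
  exact (X.mem_part_iff _ _).2 rfl

theorem apply_label_permute (π : Equiv.Perm (ZMod n)) (h : ∀ i, lam.part (π i) = lam.part i)
    (X : SetTuple lam) (x : Fin r) : π ((X.permute π h).label x) = X.label x :=
  ((X.mem_part_iff x _).1 (((X.permute π h).mem_part_iff x _).2 rfl)).symm

theorem scalar_eq_prod (X : SetTuple lam) (z : Fin r → rootsOfUnity n ℂ) :
    X.scalar z = ∏ x, ((z x : ℂˣ) : ℂ) ^ (X.label x).val := by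
  classical
  rw [← Finset.prod_fiberwise Finset.univ X.label, scalar]
  refine Finset.prod_congr rfl fun i _ => ?_
  have e : X.part i = Finset.univ.filter fun x => X.label x = i := by
    ext x
    simp [mem_part_iff]
  rw [e]
  refine Finset.prod_congr rfl fun x hx => ?_
  rw [(Finset.mem_filter.1 hx).2]

end SetTuple

/-! ### Block decomposition of traces -/

/-- The projection of `W_λ` onto `t_X ⊗ V_λ`. -/
noncomputable def blockProj (X : SetTuple lam) : Module.End ℂ (ModuleW lam) :=
  Finsupp.lsingle X ∘ₗ Finsupp.lapply X

theorem blockProj_single_self (X : SetTuple lam) (v : TensorSpace lam) :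
    blockProj X (Finsupp.single X v) = Finsupp.single X v := by
  simp [blockProj]

theorem blockProj_single_of_ne {X Y : SetTuple lam} (h : Y ≠ X) (v : TensorSpace lam) :
    blockProj X (Finsupp.single Y v) = 0 := by
  simp [blockProj, Finsupp.single_eq_of_ne h.symm]

theorem sum_blockProj [Fintype (SetTuple lam)] :
    ∑ X : SetTuple lam, blockProj X = 1 := by
  classical
  refine Finsupp.lhom_ext fun Y v => ?_
  rw [LinearMap.sum_apply, Finset.sum_eq_single Y, blockProj_single_self]
  · rfl
  · exact fun X _ h => blockProj_single_of_ne h.symm v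
  · simp

theorem mul_blockProj_ext {A B : Module.End ℂ (ModuleW lam)} (X : SetTuple lam)
    (h : ∀ v, A (Finsupp.single X v) = B (Finsupp.single X v)) :
    A * blockProj X = B * blockProj X := by
  refine LinearMap.ext fun w => ?_
  exact h (w X)

/-- With `p = blockProj X`, cyclicity gives `tr(A p) = tr(A p p) = tr(p A p)`, and `p A p = 0` since
`A` sends the block of `X` into another one. -/
theorem trace_mul_blockProj_eq_zero {A : Module.End ℂ (ModuleW lam)} {X Y : SetTuple lam}
    (hXY : Y ≠ X) (hA : ∀ v, ∃ v', A (Finsupp.single X v) = Finsupp.single Y v') :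
    LinearMap.trace ℂ _ (A * blockProj X) = 0 := by
  have h1 : A * blockProj X = A * blockProj X * blockProj X := by
    refine mul_blockProj_ext X fun v => ?_
    rw [Module.End.mul_apply, blockProj_single_self]
  have h2 : blockProj X * (A * blockProj X) = 0 := by
    refine LinearMap.ext fun w => ?_
    obtain ⟨v', hv'⟩ := hA (w X)
    change blockProj X (A (Finsupp.single X (w X))) = 0
    rw [hv', blockProj_single_of_ne hXY]
  rw [h1, LinearMap.trace_mul_comm, h2, map_zero]

theorem trace_eq_of_intertwine {V : Type*} [AddCommMonoid V] [Module ℂ V]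
    {P A B : Module.End ℂ V} (hP : IsUnit P) (h : P * A = B * P) :
    LinearMap.trace ℂ V A = LinearMap.trace ℂ V B := by
  obtain ⟨u, rfl⟩ := hP
  rw [← LinearMap.trace_conj ℂ A u, h, Units.mul_inv_cancel_right]

/-- On each block `g` differs from its permutation part by a scalar, so the diagonal part leaves the
traces altogether. -/
theorem trace_mul_rho_eq_sum [Fintype (SetTuple lam)] (A : Module.End ℂ (ModuleW lam))
    (g : GroupG n r) :
    LinearMap.trace ℂ _ (A * rho lam g) = ∑ X : SetTuple lam, (X.image g.right).scalar g.left *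
      LinearMap.trace ℂ _ (A * rho lam (SemidirectProduct.inr g.right) * blockProj X) := by
  conv_lhs => rw [← mul_one (A * rho lam g), ← sum_blockProj, Finset.mul_sum, map_sum]
  refine Finset.sum_congr rfl fun X _ => ?_
  have key : A * rho lam g * blockProj X = ((X.image g.right).scalar g.left •
      (A * rho lam (SemidirectProduct.inr g.right))) * blockProj X := by
    refine mul_blockProj_ext X fun v => ?_
    rw [Module.End.mul_apply, LinearMap.smul_apply, Module.End.mul_apply, rho_single,
      rho_inr_single, map_smul]
  rw [key, smul_mul_assoc, map_smul, smul_eq_mul]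

/-! ### Blocks fixed by a shifted permutation -/

/-- The tuple `X` is unchanged when `σ` is applied and its sets are then shifted by `a`. -/
def SetTuple.IsShiftFixed (X : SetTuple lam) (a : ZMod n) (σ : Equiv.Perm (Fin r)) : Prop :=
  ∀ x, X.label (σ x) + a = X.label x

theorem trace_shiftW_mul_blockProj_eq_zero (a : ZMod n)
    (h : ∀ i, lam.part (Equiv.addRight a i) = lam.part i) (σ : Equiv.Perm (Fin r))
    (X : SetTuple lam) (hX : ¬ X.IsShiftFixed a σ) :
    LinearMap.trace ℂ _ (shiftW lam a * rho lam (SemidirectProduct.inr σ) * blockProj X) = 0 := by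
  refine trace_mul_blockProj_eq_zero (Y := (X.image σ).permute (Equiv.addRight a) h) ?_ ?_
  · intro e
    refine hX fun x => ?_
    have := (X.image σ).apply_label_permute (Equiv.addRight a) h (σ x)
    rwa [e, SetTuple.label_image, ← Equiv.Perm.mul_apply, inv_mul_cancel,
      Equiv.Perm.one_apply] at this
  · intro v
    rw [Module.End.mul_apply, rho_inr_single, shiftW_eq_permW a h, permW_single]
    exact ⟨_, rfl⟩

theorem isUnit_permW (π : Equiv.Perm (ZMod n)) (h : ∀ i, lam.part (π i) = lam.part i) :
    IsUnit (permW lam π h) := by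
  have h' : ∀ i, lam.part (π⁻¹ i) = lam.part i := fun i => by
    simpa using (h (π⁻¹ i)).symm
  refine ⟨⟨permW lam π h, permW lam π⁻¹ h', ?_, ?_⟩, rfl⟩
  · rw [permW_mul _ _ _ _ fun i => by rw [inv_mul_cancel]; rfl,
      ← permW_one (lam := lam) fun _ => rfl]
    exact permW_congr (inv_mul_cancel π) _ _
  · rw [permW_mul _ _ _ _ fun i => by rw [mul_inv_cancel]; rfl,
      ← permW_one (lam := lam) fun _ => rfl]
    exact permW_congr (mul_inv_cancel π) _ _

/-- Conjugation by `permW π * ρ(φ)` turns the shift by `a` into the shift by `a'`, fixes the action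
of `σ`, and carries the block of `X` to that of its image. -/
theorem trace_shiftW_mul_blockProj_congr {a a' : ZMod n}
    (ha : ∀ i, lam.part (Equiv.addRight a i) = lam.part i)
    (ha' : ∀ i, lam.part (Equiv.addRight a' i) = lam.part i)
    (π : Equiv.Perm (ZMod n)) (hlam : ∀ i, lam.part (π i) = lam.part i)
    (hπ : ∀ i, π (i + a') = π i + a) (σ φ : Equiv.Perm (Fin r)) (hφ : φ * σ = σ * φ)
    (X : SetTuple lam) :
    LinearMap.trace ℂ _ (shiftW lam a * rho lam (SemidirectProduct.inr σ) * blockProj X) =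
      LinearMap.trace ℂ _ (shiftW lam a' * rho lam (SemidirectProduct.inr σ) *
        blockProj ((X.image φ).permute π hlam)) := by
  have hP : IsUnit (permW lam π hlam * rho lam (SemidirectProduct.inr φ)) :=
    (isUnit_permW π hlam).mul ((Group.isUnit _).map (rho lam))
  have hproj : permW lam π hlam * rho lam (SemidirectProduct.inr φ) * blockProj X =
      blockProj ((X.image φ).permute π hlam) *
        (permW lam π hlam * rho lam (SemidirectProduct.inr φ)) := by
    refine Finsupp.lhom_ext fun Y v => ?_
    rw [Module.End.mul_apply, Module.End.mul_apply _ _ (Finsupp.single Y v),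
      Module.End.mul_apply _ (rho lam _) (Finsupp.single Y v), rho_inr_single, permW_single]
    by_cases hYX : Y = X
    · subst hYX
      rw [blockProj_single_self, blockProj_single_self, Module.End.mul_apply, rho_inr_single,
        permW_single]
    · rw [blockProj_single_of_ne hYX, blockProj_single_of_ne, map_zero]
      intro e
      refine hYX (SetTuple.ext_label fun x => ?_)
      have h1 := (X.image φ).apply_label_permute π hlam (φ x)
      have h2 := (Y.image φ).apply_label_permute π hlam (φ x)
      rw [e, h1, SetTuple.label_image, SetTuple.label_image, ← Equiv.Perm.mul_apply,
        inv_mul_cancel, Equiv.Perm.one_apply] at h2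
      exact h2.symm
  have hshift : permW lam π hlam * shiftW lam a = shiftW lam a' * permW lam π hlam := by
    have h1 : ∀ i, lam.part ((Equiv.addRight a * π) i) = lam.part i := fun i =>
      (ha (π i)).trans (hlam i)
    have h2 : ∀ i, lam.part ((π * Equiv.addRight a') i) = lam.part i := fun i =>
      (hlam _).trans (ha' i)
    rw [shiftW_eq_permW a ha, shiftW_eq_permW a' ha', permW_mul _ _ _ _ h1, permW_mul _ _ _ _ h2]
    exact permW_congr (Equiv.ext fun i => (hπ i).symm) _ _
  have hrho : rho lam (SemidirectProduct.inr φ) * rho lam (SemidirectProduct.inr σ) =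
      rho lam (SemidirectProduct.inr σ) * rho lam (SemidirectProduct.inr φ) := by
    rw [← map_mul, ← map_mul, ← map_mul, ← map_mul, hφ]
  have hcomm : rho lam (SemidirectProduct.inr φ) * shiftW lam a =
      shiftW lam a * rho lam (SemidirectProduct.inr φ) := by
    rw [shiftW_eq_permW a ha, rho_inr_mul_permW]
  refine trace_eq_of_intertwine hP ?_
  calc _ = permW lam π hlam * (rho lam (SemidirectProduct.inr φ) * shiftW lam a) *
        rho lam (SemidirectProduct.inr σ) * blockProj X := by simp only [mul_assoc]
    _ = (permW lam π hlam * shiftW lam a) * (rho lam (SemidirectProduct.inr φ) *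
        rho lam (SemidirectProduct.inr σ)) * blockProj X := by rw [hcomm]; simp only [mul_assoc]
    _ = shiftW lam a' * (permW lam π hlam * rho lam (SemidirectProduct.inr σ)) *
        rho lam (SemidirectProduct.inr φ) * blockProj X := by
          rw [hshift, hrho]; simp only [mul_assoc]
    _ = shiftW lam a' * rho lam (SemidirectProduct.inr σ) *
        (permW lam π hlam * rho lam (SemidirectProduct.inr φ) * blockProj X) := by
          rw [← rho_inr_mul_permW]; simp only [mul_assoc]
    _ = _ := by rw [hproj]; simp only [mul_assoc]

/-! ### Shifts generating the same subgroup -/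

/-- Translations by two generators of the same subgroup are conjugate under a permutation that
preserves the cosets of this subgroup. -/
theorem exists_perm_conj_translation {A : Type*} [AddCommGroup A] [Finite A] {a a' : A}
    (h : AddSubgroup.zmultiples a = AddSubgroup.zmultiples a') :
    ∃ π : Equiv.Perm A, (∀ i, π (i + a') = π i + a) ∧
      ∀ i, π i - i ∈ AddSubgroup.zmultiples a := by
  have hord : addOrderOf a = addOrderOf a' := by
    rw [← Nat.card_zmultiples, ← Nat.card_zmultiples, h]
  have hz : ∀ m : ℤ, m • a = 0 ↔ m • a' = 0 := fun m => by
    rw [← addOrderOf_dvd_iff_zsmul_eq_zero, ← addOrderOf_dvd_iff_zsmul_eq_zero, hord]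
  -- Equal orders make `m • a' ↦ m • a` well defined and injective, although the coefficient `m` is
  -- not unique.
  have hz' : ∀ m m' : ℤ, m • a = m' • a ↔ m • a' = m' • a' := fun m m' => by
    rw [← sub_eq_zero, ← sub_smul, hz, sub_smul, sub_eq_zero]
  let q : A → A := fun i => (QuotientAddGroup.mk i : A ⧸ AddSubgroup.zmultiples a').out
  have hq : ∀ i j, q i = q j ↔ ∃ m : ℤ, j = i + m • a' := by
    intro i j
    constructor
    · intro e
      have e' := congrArg (QuotientAddGroup.mk : A → A ⧸ AddSubgroup.zmultiples a') e
      simp only [q, QuotientAddGroup.out_eq'] at e'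
      obtain ⟨m, hm⟩ := AddSubgroup.mem_zmultiples_iff.1 (QuotientAddGroup.eq.1 e')
      exact ⟨m, by rw [hm, add_neg_cancel_left]⟩
    · rintro ⟨m, rfl⟩
      have : (QuotientAddGroup.mk i : A ⧸ AddSubgroup.zmultiples a') =
          QuotientAddGroup.mk (i + m • a') :=
        QuotientAddGroup.eq.2 (AddSubgroup.mem_zmultiples_iff.2 ⟨m, by rw [neg_add_cancel_left]⟩)
      simp only [q, this]
  have hm : ∀ i, ∃ m : ℤ, i = q i + m • a' := by
    intro i
    have e : q (q i) = q i := by simp only [q, QuotientAddGroup.out_eq']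
    exact (hq _ _).1 e
  choose m hm using hm
  -- On the coset with chosen representative `q`, this sends `q + m • a'` to `q + m • a`.
  let π : A → A := fun i => q i + m i • a
  have hinj : Function.Injective π := by
    intro i j hij
    have hmem : ∀ i, π i - q i ∈ AddSubgroup.zmultiples a := fun i =>
      AddSubgroup.mem_zmultiples_iff.2 ⟨m i, by simp [π]⟩
    have e : q (q i) = q (q j) := by
      have h1 := AddSubgroup.sub_mem _ (hmem j) (hmem i)
      rw [← hij, sub_sub_sub_cancel_left, h] at h1
      obtain ⟨c, hc⟩ := AddSubgroup.mem_zmultiples_iff.1 h1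
      exact ((hq _ _).2 ⟨c, by rw [hc, add_sub_cancel]⟩).symm
    simp only [q, QuotientAddGroup.out_eq'] at e
    change q i = q j at e
    have e2 : m i • a = m j • a := by
      have : q i + m i • a = q j + m j • a := hij
      rwa [e, add_left_cancel_iff] at this
    rw [hm i, hm j, e, (hz' _ _).1 e2]
  refine ⟨Equiv.ofBijective π (Finite.injective_iff_bijective.1 hinj), fun i => ?_, fun i => ?_⟩
  · have e : q (i + a') = q i := ((hq _ _).2 ⟨1, by rw [one_smul]⟩).symm
    -- The chosen integers `m (i + a')` and `m i + 1` may differ; only their multiples of `a'`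
    -- agree, and `hz'` carries this over to `a`.
    have e2 : m (i + a') • a' = (m i + 1) • a' := by
      have h1 := hm (i + a')
      rw [e] at h1
      nth_rw 1 [hm i] at h1
      rw [add_assoc, add_left_cancel_iff] at h1
      rw [← h1, add_smul, one_smul]
    change q (i + a') + m (i + a') • a = q i + m i • a + a
    rw [e, (hz' _ _).2 e2, add_smul, one_smul, add_assoc]
  · change q i + m i • a - i ∈ _
    have e : q i + m i • a - i = m i • a - m i • a' := by
      rw [sub_eq_iff_eq_add, sub_add_eq_add_sub, eq_sub_iff_add_eq, add_right_comm, ← hm i,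
        add_comm]
    rw [e]
    refine AddSubgroup.sub_mem _ (AddSubgroup.zsmul_mem_zmultiples a _) ?_
    rw [h]
    exact AddSubgroup.zsmul_mem_zmultiples a' _

/-! ### Tuples fixed by a shifted permutation, and their transport between two shifts. -/

namespace SetTuple

theorem IsShiftFixed.label_zpow {X : SetTuple lam} {a : ZMod n} {σ : Equiv.Perm (Fin r)}
    (hX : X.IsShiftFixed a σ) (m : ℤ) (x : Fin r) : X.label ((σ ^ m) x) = X.label x - m • a := by
  induction m with
  | zero => simp
  | succ m ih =>
    rw [add_comm, zpow_add, zpow_one, Equiv.Perm.mul_apply, ← add_sub_cancel_right (X.label _) a,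
      hX, ih, add_smul, one_smul]
    abel
  | pred m ih =>
    rw [sub_eq_neg_add, zpow_add, zpow_neg_one, Equiv.Perm.mul_apply, ← hX,
      ← Equiv.Perm.mul_apply, mul_inv_cancel, Equiv.Perm.one_apply, ih, add_smul, neg_one_smul]
    abel

/-- Each application of `σ` subtracts `a` from the label, so one label determines all those on its
cycle. -/
theorem IsShiftFixed.eq_of_label_eq {X Y : SetTuple lam} {a : ZMod n} {σ : Equiv.Perm (Fin r)}
    (hX : X.IsShiftFixed a σ) (hY : Y.IsShiftFixed a σ) {rep : Fin r → Fin r}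
    (hrep : ∀ x, σ.SameCycle (rep x) x) (h : ∀ x, X.label (rep x) = Y.label (rep x)) : X = Y := by
  refine ext_label fun x => ?_
  obtain ⟨m, hm⟩ := hrep x
  rw [← hm, hX.label_zpow, hY.label_zpow, h]

end SetTuple

theorem rep_zpow {α β : Type*} {σ : Equiv.Perm α} {rep : α → β} (hrep : ∀ x, rep (σ x) = rep x)
    (m : ℤ) (x : α) : rep ((σ ^ m) x) = rep x := by
  induction m with
  | zero => simp
  | succ m ih => rw [add_comm, zpow_add, zpow_one, Equiv.Perm.mul_apply, hrep, ih]
  | pred m ih =>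
    rw [sub_eq_neg_add, zpow_add, zpow_neg_one, Equiv.Perm.mul_apply, ← hrep,
      ← Equiv.Perm.mul_apply, mul_inv_cancel, Equiv.Perm.one_apply, ih]

/-- The permutation which acts on every cycle of `σ` as some power of `σ`, depending on the
cycle. -/
def cyclewisePow (σ : Equiv.Perm (Fin r)) (rep : Fin r → Fin r) (hrep : ∀ x, rep (σ x) = rep x)
    (j : Fin r → ℤ) : Equiv.Perm (Fin r) :=
  { toFun := fun x => (σ ^ j (rep x)) x
    invFun := fun x => (σ ^ (-j (rep x))) x
    left_inv := fun x => by
      beta_reduce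
      rw [rep_zpow hrep, ← Equiv.Perm.mul_apply, ← zpow_add, neg_add_cancel, zpow_zero,
        Equiv.Perm.one_apply]
    right_inv := fun x => by
      beta_reduce
      rw [rep_zpow hrep, ← Equiv.Perm.mul_apply, ← zpow_add, add_neg_cancel, zpow_zero,
        Equiv.Perm.one_apply] }

theorem cyclewisePow_mul_comm (σ : Equiv.Perm (Fin r)) (rep : Fin r → Fin r)
    (hrep : ∀ x, rep (σ x) = rep x) (j : Fin r → ℤ) :
    cyclewisePow σ rep hrep j * σ = σ * cyclewisePow σ rep hrep j := by
  ext1 x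
  change (σ ^ j (rep (σ x))) (σ x) = σ ((σ ^ j (rep x)) x)
  rw [hrep, ← Equiv.Perm.mul_apply, ← Equiv.Perm.mul_apply, (Commute.self_zpow σ _).eq]

/-- A tuple fixed under `(a, σ)` corresponds to a tuple fixed under `(a', σ)`, with the same labels
on a system of representatives of the cycles, in such a way that the traces on the blocks agree. -/
theorem exists_isShiftFixed_of_zmultiples_eq {a a' : ZMod n}
    (h : AddSubgroup.zmultiples a = AddSubgroup.zmultiples a')
    (ha : ∀ i, lam.part (i + a) = lam.part i) {σ : Equiv.Perm (Fin r)} {rep : Fin r → Fin r}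
    (hrep : ∀ x, rep (σ x) = rep x) (hcyc : ∀ x, σ.SameCycle (rep x) x)
    {X : SetTuple lam} (hX : X.IsShiftFixed a σ) :
    ∃ Y : SetTuple lam, Y.IsShiftFixed a' σ ∧ (∀ x, Y.label (rep x) = X.label (rep x)) ∧
      LinearMap.trace ℂ _ (shiftW lam a * rho lam (SemidirectProduct.inr σ) * blockProj X) =
        LinearMap.trace ℂ _ (shiftW lam a' * rho lam (SemidirectProduct.inr σ) * blockProj Y) := by
  have hinv : ∀ c ∈ AddSubgroup.zmultiples a, ∀ i, lam.part (i + c) = lam.part i := by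
    intro c hc i
    obtain ⟨m, -, rfl⟩ := Finset.mem_image.1 (mem_zmultiples_iff_mem_range_addOrderOf.1 hc)
    exact part_addRight_nsmul ha _ i
  obtain ⟨π, hπ, hcos⟩ := exists_perm_conj_translation h
  have hlam : ∀ i, lam.part (π i) = lam.part i := fun i => by
    rw [← hinv _ (hcos i) i, add_sub_cancel]
  have hj : ∀ x, ∃ m : ℤ, π (X.label x) = X.label x + m • a := fun x => by
    obtain ⟨m, hm⟩ := AddSubgroup.mem_zmultiples_iff.1 (hcos (X.label x))
    exact ⟨m, by rw [hm, add_sub_cancel]⟩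
  choose j hj using hj
  have hreprep : ∀ x, rep (rep x) = rep x := fun x => by
    obtain ⟨m, hm⟩ := hcyc x
    rw [← rep_zpow hrep m (rep x), hm]
  -- At a representative, applying `φ` changes the label `l` of `X` to `l + j • a = π l`, which the
  -- permutation of components by `π` then undoes.
  let φ := cyclewisePow σ rep hrep j
  refine ⟨(X.image φ).permute π hlam, fun x => ?_, fun x => ?_,
    trace_shiftW_mul_blockProj_congr ha (hinv a' ?_) π hlam hπ σ φ
      (cyclewisePow_mul_comm σ rep hrep j) X⟩
  · apply π.injective
    rw [hπ, SetTuple.apply_label_permute, SetTuple.apply_label_permute, SetTuple.label_image,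
      SetTuple.label_image, ← hX (φ⁻¹ x)]
    have e : φ⁻¹ * σ = σ * φ⁻¹ :=
      (show Commute φ σ from cyclewisePow_mul_comm σ rep hrep j).inv_left
    rw [← Equiv.Perm.mul_apply, e, Equiv.Perm.mul_apply]
  · apply π.injective
    rw [SetTuple.apply_label_permute, SetTuple.label_image, hj]
    change X.label ((σ ^ (-j (rep (rep x)))) (rep x)) = _
    rw [hreprep, hX.label_zpow, neg_smul, sub_neg_eq_add]
  · rw [h]
    exact AddSubgroup.mem_zmultiples a'

/-- The hypothesis `hg` makes the scalar of `X.image g.right` read the labels of `X` only at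
representatives of cycles, where the transport of fixed tuples preserves them. -/
theorem trace_shiftW_mul_rho_eq {a a' : ZMod n}
    (h : AddSubgroup.zmultiples a = AddSubgroup.zmultiples a')
    (ha : ∀ i, lam.part (i + a) = lam.part i) (ha' : ∀ i, lam.part (i + a') = lam.part i)
    (g : GroupG n r) {rep : Fin r → Fin r} (hrep : ∀ x, rep (g.right x) = rep x)
    (hcyc : ∀ x, g.right.SameCycle (rep x) x)
    (hg : ∀ x, g.left x ≠ 1 → rep (g.right⁻¹ x) = g.right⁻¹ x) :
    LinearMap.trace ℂ _ (shiftW lam a * rho lam g) =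
      LinearMap.trace ℂ _ (shiftW lam a' * rho lam g) := by
  classical
  have := Fintype.ofFinite (SetTuple lam)
  have hscalar : ∀ X Y : SetTuple lam, (∀ x, Y.label (rep x) = X.label (rep x)) →
      (X.image g.right).scalar g.left = (Y.image g.right).scalar g.left := by
    intro X Y hXY
    rw [SetTuple.scalar_eq_prod, SetTuple.scalar_eq_prod]
    refine Finset.prod_congr rfl fun x _ => ?_
    by_cases hx : g.left x = 1
    · simp [hx]
    · rw [SetTuple.label_image, SetTuple.label_image, ← hg x hx, hXY]
  choose F hF hFlab hFtr using fun (X : SetTuple lam) (hX : X.IsShiftFixed a g.right) =>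
    exists_isShiftFixed_of_zmultiples_eq h ha hrep hcyc hX
  choose F' hF' hFlab' _ using fun (X : SetTuple lam) (hX : X.IsShiftFixed a' g.right) =>
    exists_isShiftFixed_of_zmultiples_eq h.symm ha' hrep hcyc hX
  have hsum : ∀ c : ZMod n, (∀ i, lam.part (i + c) = lam.part i) →
      LinearMap.trace ℂ _ (shiftW lam c * rho lam g) =
        ∑ X : SetTuple lam with X.IsShiftFixed c g.right, (X.image g.right).scalar g.left *
          LinearMap.trace ℂ _
            (shiftW lam c * rho lam (SemidirectProduct.inr g.right) * blockProj X) := by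
    intro c hc
    rw [trace_mul_rho_eq_sum, Finset.sum_filter_of_ne]
    intro X _ hX
    by_contra hfix
    exact hX (by rw [trace_shiftW_mul_blockProj_eq_zero c hc _ _ hfix, mul_zero])
  rw [hsum a ha, hsum a' ha']
  -- The transports in the two directions come from independent choices; they are mutually inverse
  -- because both preserve the labels that determine a fixed tuple.
  refine Finset.sum_bij' (fun X hX => F X (Finset.mem_filter.1 hX).2)
    (fun X hX => F' X (Finset.mem_filter.1 hX).2) ?_ ?_ ?_ ?_ ?_
  · exact fun X hX => Finset.mem_filter.2 ⟨Finset.mem_univ _, hF X _⟩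
  · exact fun X hX => Finset.mem_filter.2 ⟨Finset.mem_univ _, hF' X _⟩
  · exact fun X hX => (hF' _ _).eq_of_label_eq (Finset.mem_filter.1 hX).2 hcyc fun x => by
      rw [hFlab', hFlab]
  · exact fun X hX => (hF _ _).eq_of_label_eq (Finset.mem_filter.1 hX).2 hcyc fun x => by
      rw [hFlab, hFlab']
  · intro X hX
    rw [hFtr X (Finset.mem_filter.1 hX).2, hscalar X _ (hFlab X (Finset.mem_filter.1 hX).2)]

end

section

variable {n r : ℕ}

/-! ### The representatives of the conjugacy classes -/

/-- If every cycle of `σ` contains at most one of the marked elements, there are representatives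
of the cycles such that the images of the representatives contain all marked elements. -/
theorem exists_cycle_rep {α : Type*} (σ : Equiv.Perm α) (mark : α → Prop)
    (h : ∀ x y, mark x → mark y → σ.SameCycle x y → x = y) :
    ∃ rep : α → α, (∀ x, rep (σ x) = rep x) ∧ (∀ x, σ.SameCycle (rep x) x) ∧
      ∀ x, mark x → rep (σ⁻¹ x) = σ⁻¹ x := by
  classical
  let s := Equiv.Perm.SameCycle.setoid σ
  have hex : ∀ c : Quotient s, ∃ y, Quotient.mk s y = c ∧ ∀ x, mark x → Quotient.mk s x = c →
      y = σ⁻¹ x := by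
    intro c
    by_cases hc : ∃ x, mark x ∧ Quotient.mk s x = c
    · obtain ⟨x, hx, rfl⟩ := hc
      -- The representative is `σ⁻¹ x`, not `x`, because the label of `X.image σ` at `x` is that of
      -- `X` at `σ⁻¹ x`.
      refine ⟨σ⁻¹ x, Quotient.sound ⟨1, by simp⟩, ?_⟩
      intro y hy hyx
      rw [h y x hy hx (Quotient.exact hyx)]
    · push Not at hc
      exact ⟨c.out, c.out_eq, fun x hx hxc => absurd hxc (hc x hx)⟩
  choose f hf hf' using hex
  refine ⟨fun x => f (Quotient.mk s x), fun x => ?_, fun x => Quotient.exact (hf _), fun x hx => ?_⟩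
  · exact congrArg f (Quotient.sound (Equiv.Perm.sameCycle_apply_left.2 (.refl σ x)))
  · exact hf' _ x hx (Quotient.sound ⟨-1, by simp⟩)

theorem cycleElt_left_ne_one [NeZero r] (ζ : rootsOfUnity n ℂ) {a l : ℕ} (u : ZMod n) (ha : a < r)
    {x : Fin r} (hx : (cycleElt r ζ a l u).left x ≠ 1) : (x : ℕ) = a := by
  by_contra h
  refine hx (Pi.mulSingle_eq_of_ne (fun e => h ?_) _)
  rw [e]
  exact Nat.mod_eq_of_lt ha

theorem mem_range'_map_ofNat [NeZero r] {a l : ℕ} (hal : a + l ≤ r) (x : Fin r) :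
    x ∈ (List.range' a l).map (Fin.ofNat r) ↔ a ≤ x ∧ (x : ℕ) < a + l := by
  rw [List.mem_map]
  constructor
  · rintro ⟨y, hy, rfl⟩
    rw [List.mem_range'_1] at hy
    have : (Fin.ofNat r y : ℕ) = y := Nat.mod_eq_of_lt (by omega)
    omega
  · intro hx
    exact ⟨x, List.mem_range'_1.2 hx, Fin.ext (Nat.mod_eq_of_lt x.2)⟩

theorem cycleElt_right_apply_of_not_mem [NeZero r] (ζ : rootsOfUnity n ℂ) {a l : ℕ} (u : ZMod n)
    (hal : a + l ≤ r) {x : Fin r} (hx : ¬ (a ≤ x ∧ (x : ℕ) < a + l)) :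
    (cycleElt r ζ a l u).right x = x :=
  List.formPerm_apply_of_notMem fun h => hx ((mem_range'_map_ofNat hal x).1 h)

theorem cycleElt_right_apply_mem [NeZero r] (ζ : rootsOfUnity n ℂ) {a l : ℕ} (u : ZMod n)
    (hal : a + l ≤ r) {x : Fin r} (hx : a ≤ x ∧ (x : ℕ) < a + l) :
    a ≤ (cycleElt r ζ a l u).right x ∧ ((cycleElt r ζ a l u).right x : ℕ) < a + l :=
  (mem_range'_map_ofNat hal _).1
    (List.formPerm_apply_mem_of_mem ((mem_range'_map_ofNat hal x).2 hx))

/-- Two permutations that agree on a subset stable under the first one have the same powers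
there. -/
theorem zpow_apply_eq_of_forall_mem {α : Type*} [Finite α] {σ τ : Equiv.Perm α} {p : α → Prop}
    (hp : ∀ x, p x → p (σ x)) (h : ∀ x, p x → σ x = τ x) (m : ℤ) {x : α} (hx : p x) :
    p ((σ ^ m) x) ∧ (σ ^ m) x = (τ ^ m) x := by
  have hinv : ∀ x, p x → p (σ⁻¹ x) ∧ σ⁻¹ x = τ⁻¹ x := by
    intro x hx
    have h1 : p (σ⁻¹ x) :=
      Equiv.Perm.perm_symm_mapsTo_of_mapsTo σ (s := {x | p x}) (fun x hx => hp x hx) hx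
    refine ⟨h1, ?_⟩
    rw [Equiv.Perm.eq_inv_iff_eq, ← h _ h1, ← Equiv.Perm.mul_apply, mul_inv_cancel,
      Equiv.Perm.one_apply]
  induction m with
  | zero => exact ⟨hx, rfl⟩
  | succ m ih =>
    rw [add_comm, zpow_add, zpow_add, zpow_one, zpow_one, Equiv.Perm.mul_apply,
      Equiv.Perm.mul_apply, ← ih.2, ← h _ ih.1]
    exact ⟨hp _ ih.1, rfl⟩
  | pred m ih =>
    rw [sub_eq_neg_add, zpow_add, zpow_add, zpow_neg_one, zpow_neg_one, Equiv.Perm.mul_apply,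
      Equiv.Perm.mul_apply, ← ih.2]
    exact hinv _ ih.1

/-- The factors act on disjoint intervals, each marked at most at its starting point. The first two
conclusions keep the tail of the product away from the first interval in the induction. Positive
lengths ensure that a starting point lies in its own interval, below `r`. -/
theorem cyclesFrom_marks [NeZero r] (ζ : rootsOfUnity n ℂ) (L : List (ℕ × ZMod n)) (a : ℕ)
    (hpos : ∀ p ∈ L, 0 < p.1) (hsum : a + (L.map Prod.fst).sum ≤ r) :
    (∀ x : Fin r, (cyclesFrom r ζ a L).left x ≠ 1 → a ≤ x) ∧
      (∀ x : Fin r, (x : ℕ) < a → (cyclesFrom r ζ a L).right x = x) ∧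
      ∀ x y : Fin r, (cyclesFrom r ζ a L).left x ≠ 1 → (cyclesFrom r ζ a L).left y ≠ 1 →
        (cyclesFrom r ζ a L).right.SameCycle x y → x = y := by
  induction L generalizing a with
  | nil => exact ⟨fun x hx => absurd rfl hx, fun x _ => rfl, fun x y hx => absurd rfl hx⟩
  | cons p L ih =>
    obtain ⟨l, u⟩ := p
    have hl : 0 < l := hpos (l, u) List.mem_cons_self
    rw [List.map_cons, List.sum_cons] at hsum
    obtain ⟨ih1, ih2, ih3⟩ := ih (a + l) (fun p hp => hpos p (List.mem_cons_of_mem _ hp))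
      (by dsimp only at hsum; omega)
    have hal : a + l ≤ r := by dsimp only at hsum; omega
    rw [cyclesFrom]
    set c := cycleElt r ζ a l u
    set h := cyclesFrom r ζ (a + l) L
    have hfix : ∀ x : Fin r, ¬ (a ≤ x ∧ (x : ℕ) < a + l) → c.right x = x := fun x =>
      cycleElt_right_apply_of_not_mem ζ u hal
    have hmem : ∀ x : Fin r, (x : ℕ) < a + l → (c.right x : ℕ) < a + l := by
      intro x hx
      by_cases hax : a ≤ x
      · exact (cycleElt_right_apply_mem ζ u hal ⟨hax, hx⟩).2
      · rwa [hfix x fun h => hax h.1]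
    have hhmem : ∀ x : Fin r, a + l ≤ (x : ℕ) → a + l ≤ (h.right x : ℕ) := by
      intro x hx
      by_contra hlt
      have := h.right.injective (ih2 _ (not_le.1 hlt))
      omega
    have hleft : ∀ x : Fin r, (c * h).left x ≠ 1 → (x : ℕ) = a ∨ (a + l ≤ x ∧ h.left x ≠ 1) := by
      intro x hx
      by_cases hcx : c.left x = 1
      · right
        have hx' : h.left (c.right⁻¹ x) ≠ 1 := fun e => hx (by
          change c.left x * h.left (c.right⁻¹ x) = 1
          rw [hcx, e, mul_one])
        have hle := ih1 _ hx'
        have e : c.right⁻¹ x = x := by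
          have e1 := hfix (c.right⁻¹ x) (by omega)
          rw [← Equiv.Perm.mul_apply, mul_inv_cancel, Equiv.Perm.one_apply] at e1
          exact e1.symm
        rw [e] at hle hx'
        exact ⟨hle, hx'⟩
      · exact .inl (cycleElt_left_ne_one ζ u (by omega) hcx)
    have hlow : ∀ x : Fin r, (x : ℕ) < a + l → ((c * h).right x : ℕ) < a + l := by
      intro x hx
      rw [SemidirectProduct.mul_right, Equiv.Perm.mul_apply, ih2 x hx]
      exact hmem x hx
    have hhigh : ∀ x : Fin r, a + l ≤ (x : ℕ) → h.right x = (c * h).right x := by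
      intro x hx
      rw [SemidirectProduct.mul_right, Equiv.Perm.mul_apply, hfix]
      have := hhmem x hx
      omega
    have hsame : ∀ x y : Fin r, (x : ℕ) < a + l → (c * h).right.SameCycle x y →
        (y : ℕ) < a + l := by
      rintro x _ hx ⟨m, rfl⟩
      exact (zpow_apply_eq_of_forall_mem (p := fun x : Fin r => (x : ℕ) < a + l) hlow
        (fun _ _ => rfl) m hx).1
    refine ⟨fun x hx => ?_, fun x hx => ?_, fun x y hx hy hxy => ?_⟩
    · rcases hleft x hx with h | h <;> omega
    · rw [SemidirectProduct.mul_right, Equiv.Perm.mul_apply, ih2 x (by omega), hfix x (by omega)]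
    · rcases hleft x hx with hxa | ⟨hxa, hx'⟩
      · rcases hleft y hy with hya | ⟨hya, hy'⟩
        · exact Fin.ext (hxa.trans hya.symm)
        · have := hsame x y (by omega) hxy
          omega
      · rcases hleft y hy with hya | ⟨hya, hy'⟩
        · have := hsame y x (by omega) hxy.symm
          omega
        · refine ih3 x y hx' hy' ?_
          obtain ⟨m, hm⟩ := hxy
          exact ⟨m, (zpow_apply_eq_of_forall_mem (p := fun x : Fin r => a + l ≤ (x : ℕ)) hhmem
            hhigh m hxa).2.trans hm⟩

theorem _root_.YoungDiagram.sum_rowLens (μ : YoungDiagram) : μ.rowLens.sum = μ.card := by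
  have h : ∀ c ∈ μ.cells, c.1 ∈ Finset.range (μ.colLen 0) := fun c hc =>
    Finset.mem_range.2 ((YoungDiagram.mem_iff_lt_colLen.1 hc).trans_le
      (μ.colLen_anti _ _ c.2.zero_le))
  rw [YoungDiagram.card, Finset.card_eq_sum_card_fiberwise h]
  exact (Finset.sum_congr rfl fun i _ => μ.rowLen_eq_card).symm ▸ rfl

theorem Enumerates.pos [NeZero n] {L : List (ℕ × ZMod n)} {eta : MultiPartition n r}
    (hL : Enumerates L eta) (p : ℕ × ZMod n) (hp : p ∈ L) : 0 < p.1 := by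
  refine (eta.part p.2).pos_of_mem_rowLens p.1 ?_
  rw [← Multiset.mem_coe, ← hL p.2, Multiset.mem_coe, List.mem_map]
  exact ⟨p, List.mem_filter.2 ⟨hp, by simp⟩, rfl⟩

theorem Enumerates.sum_eq [NeZero n] {L : List (ℕ × ZMod n)} {eta : MultiPartition n r}
    (hL : Enumerates L eta) : (L.map Prod.fst).sum = r := by
  have h : ∀ u, ((L.filter fun p => p.2 = u).map Prod.fst).sum = (eta.part u).card := fun u => by
    rw [← YoungDiagram.sum_rowLens, ← Multiset.sum_coe, hL u, Multiset.sum_coe]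
  rw [← eta.sum_card, ← Finset.sum_congr rfl fun u _ => h u]
  -- What remains is an identity for arbitrary lists, so the induction must not carry the
  -- multipartition along.
  clear hL h
  induction L with
  | nil => simp
  | cons p L ih =>
    have e : ∀ u, (((p :: L).filter fun p => p.2 = u).map Prod.fst).sum =
        (if p.2 = u then p.1 else 0) + ((L.filter fun p => p.2 = u).map Prod.fst).sum := fun u => by
      by_cases hu : p.2 = u <;> simp [hu]
    rw [List.map_cons, List.sum_cons, ih, Finset.sum_congr rfl fun u _ => e u,
      Finset.sum_add_distrib, Finset.sum_ite_eq, if_pos (Finset.mem_univ _)]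

/-! ### Orders -/

theorem orderOf_eps [NeZero r] {d e : ℕ} [NeZero d] [NeZero e] {ζ : rootsOfUnity (d * e) ℂ}
    (hζ : Subgroup.zpowers ζ = ⊤) : orderOf (eps d e r) = e := by
  have happly : ∀ (m : ℕ) (g : GroupG (d * e) r),
      (eps d e r ^ m) g = ((∏ x, g.left x) ^ (d * m) : rootsOfUnity (d * e) ℂ) := fun m g => by
    rw [MonoidHom.pow_apply, pow_mul]
    rfl
  have hone : ∀ y : rootsOfUnity (d * e) ℂ, y ^ (d * e) = 1 := fun y =>
    Subtype.ext ((mem_rootsOfUnity _ _).1 y.2)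
  refine Nat.dvd_antisymm (orderOf_dvd_of_pow_eq_one ?_) ?_
  · ext1 g
    rw [happly, hone]
    rfl
  · have h1 := happly (orderOf (eps d e r)) ⟨Pi.mulSingle 0 ζ, 1⟩
    have h0 : ∏ x : Fin r, (Pi.mulSingle 0 ζ : Fin r → rootsOfUnity (d * e) ℂ) x = ζ := by
      rw [Finset.prod_eq_single 0 _ (by simp)]
      · exact Pi.mulSingle_eq_same (M := fun _ => rootsOfUnity (d * e) ℂ) 0 ζ
      · exact fun x _ hx =>
          Pi.mulSingle_eq_of_ne (M := fun _ => rootsOfUnity (d * e) ℂ) hx ζ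
    rw [pow_orderOf_eq_one, MonoidHom.one_apply, h0] at h1
    have h2 := orderOf_dvd_of_pow_eq_one (Subtype.ext h1.symm)
    rw [orderOf_eq_card_of_zpowers_eq_top hζ, Complex.card_rootsOfUnity] at h2
    exact Nat.dvd_of_mul_dvd_mul_left (NeZero.pos d) h2

/-- A nonzero shift changes the label of the point `0` in every tuple, so it moves every block;
nontriviality provides a nonzero vector in some block. -/
theorem shiftW_eq_one_iff [NeZero n] [NeZero r] {lam : MultiPartition n r}
    [Nontrivial (ModuleW lam)] (a : ZMod n)
    (h : ∀ i, lam.part (i + a) = lam.part i) : shiftW lam a = 1 ↔ a = 0 := by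
  have h' : ∀ i, lam.part (Equiv.addRight a i) = lam.part i := h
  constructor
  · intro e
    obtain ⟨w, hw⟩ := exists_ne (0 : ModuleW lam)
    obtain ⟨X, hX⟩ := Finsupp.ne_iff.1 hw
    have h1 := LinearMap.congr_fun e (Finsupp.single X (w X))
    rw [shiftW_eq_permW a h', permW_single, Module.End.one_apply,
      Finsupp.single_eq_single_iff] at h1
    rcases h1 with h1 | h1
    · have h2 := X.apply_label_permute (Equiv.addRight a) h' 0
      rw [h1.1] at h2
      exact add_eq_left.1 h2
    · exact absurd h1.2 hX
  · rintro rfl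
    rw [shiftW_eq_permW 0 h', ← permW_one (lam := lam) fun _ => rfl]
    exact permW_congr (by ext; simp) _ _

theorem orderOf_shiftW [NeZero n] [NeZero r] {lam : MultiPartition n r}
    [Nontrivial (ModuleW lam)] (a : ZMod n) (h : ∀ i, lam.part (i + a) = lam.part i) :
    orderOf (shiftW lam a) = addOrderOf a := by
  rw [← orderOf_ofAdd_eq_addOrderOf, orderOf_eq_orderOf_iff]
  intro m
  rw [shiftW_pow a h, shiftW_eq_one_iff (m • a) (part_addRight_nsmul h m),
    ← ofAdd_nsmul, ofAdd_eq_one]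

/-- One inclusion holds because the gcd divides `k`; both subgroups have order `addOrderOf a / gcd`.
-/
theorem zmultiples_nsmul_eq_of_gcd {A : Type*} [AddGroup A] [Finite A] (a : A) (k : ℕ) :
    AddSubgroup.zmultiples (k • a) =
      AddSubgroup.zmultiples ((addOrderOf a).gcd k • a) := by
  refine AddSubgroup.eq_of_le_of_card_ge ?_ ?_
  · rw [AddSubgroup.zmultiples_le]
    obtain ⟨c, hc⟩ := Nat.gcd_dvd_right (addOrderOf a) k
    refine AddSubgroup.mem_zmultiples_iff.2 ⟨c, ?_⟩
    rw [natCast_zsmul, ← mul_nsmul, ← hc]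
  · rw [Nat.card_zmultiples, Nat.card_zmultiples, addOrderOf_nsmul, addOrderOf_nsmul,
      Nat.gcd_eq_right (Nat.gcd_dvd_left _ _)]

end

end ReflectionGroup

theorem theorem3 (d e r : ℕ) [NeZero d] [NeZero e] [NeZero r]
    (ζ : rootsOfUnity (d * e) ℂ) (hζ : Subgroup.zpowers ζ = ⊤)
    (lam : MultiPartition (d * e) r) (b : ℕ) (hb : b ∣ e)
    (hC : stabilizerC d e r lam =
      (Subgroup.zpowers (eps d e r ^ b) : Set (GroupG (d * e) r →* ℂˣ)))
    (eta : MultiPartition (d * e) r) (L : List (ℕ × ZMod (d * e))) (hL : Enumerates L eta)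
    (k : ℕ) (hk : k < Nat.card (stabilizerC d e r lam))
    (b' : ℕ) (hb' : 1 ≤ b') (hb'C : b' ≤ Nat.card (stabilizerC d e r lam))
    (hord : b' * orderOf (intertwinerM d e r lam b ^ k) = Nat.card (stabilizerC d e r lam)) :
    Delta d e r lam b k (cyclesFrom r ζ 0 L) = Delta d e r lam b b' (cyclesFrom r ζ 0 L) := by
  have hDelta : ∀ m g, Delta d e r lam b m g =
      LinearMap.trace ℂ _ (shiftW lam ((d * b : ℕ) : ZMod (d * e)) ^ m * rho lam g) :=
    fun _ _ => rfl
  rw [hDelta, hDelta]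
  rw [intertwinerM] at hord
  set a : ZMod (d * e) := ((d * b : ℕ) : ZMod (d * e)) with ha
  by_cases hlam : ∀ i, lam.part (i + a) = lam.part i
  swap -- here `M_λ` is the identity by convention
  · have h1 : shiftW lam a = 1 := dif_neg hlam
    rw [h1, one_pow, one_pow]
  rcases subsingleton_or_nontrivial (ModuleW lam) with hW | hW
  · exact congrArg _ (LinearMap.ext fun _ => Subsingleton.elim _ _)
  -- Both numbers are `e / b`: `ε` has order `e`, and `d * b` divides `d * e`.
  have hcard : Nat.card (stabilizerC d e r lam) = addOrderOf a := by
    have h1 : Nat.card (stabilizerC d e r lam) = orderOf (eps d e r ^ b) := by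
      rw [hC]
      exact Nat.card_zpowers _
    rw [h1, ha, ZMod.addOrderOf_coe _ (NeZero.ne _), Nat.gcd_mul_left, Nat.gcd_eq_right hb,
      Nat.mul_div_mul_left _ _ (NeZero.pos d),
      orderOf_pow_of_dvd (ne_zero_of_dvd_ne_zero (NeZero.ne e) hb) (by rwa [orderOf_eps hζ]),
      orderOf_eps hζ]
  -- The order of `M^k` is `|C| / gcd(|C|, k)`, so `hord` leaves no other value. For `k = 0` it is
  -- `b' = |C|`.
  have hb'gcd : b' = (addOrderOf a).gcd k := by
    rw [hcard, shiftW_pow a hlam, orderOf_shiftW (k • a) (part_addRight_nsmul hlam k),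
      addOrderOf_nsmul] at hord
    have hdvd := Nat.gcd_dvd_left (addOrderOf a) k
    refine Nat.eq_of_mul_eq_mul_right
      (Nat.div_pos (Nat.le_of_dvd (addOrderOf_pos a) hdvd)
        (Nat.gcd_pos_of_pos_left _ (addOrderOf_pos a))) (hord.trans (Nat.mul_div_cancel' hdvd).symm)
  obtain ⟨-, -, hmarks⟩ := cyclesFrom_marks (r := r) ζ L 0 hL.pos (by rw [hL.sum_eq, zero_add])
  obtain ⟨rep, hrep, hcyc, hmark⟩ := exists_cycle_rep (cyclesFrom r ζ 0 L).right
    (fun x => (cyclesFrom r ζ 0 L).left x ≠ 1) hmarks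
  rw [shiftW_pow a hlam, shiftW_pow a hlam]
  refine trace_shiftW_mul_rho_eq ?_ (part_addRight_nsmul hlam k) (part_addRight_nsmul hlam b') _
    hrep hcyc hmark
  rw [hb'gcd]
  exact zmultiples_nsmul_eq_of_gcd a k
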